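/- Let $d\in[0,1]$ and, for each $n$, let $w_n=w_n[1]\cdots w_n[n]\in\{0,1\}^n$ be a binary word of length $n$ such that $\|w_n\|_1:=\sum_{j=1}^n w_n[j]=dn+o(n)$ as $n\to\infty$. Definitions. A word $w\in\{0,1\}^n$ is $(d,\varepsilon)$-uniform if $\bigl|\sum_{i\in I}w[i]-d|I|\bigr|\le\varepsilon n$ for every interval $I\subseteq\{1,\dots,n\}$. For $u\in\{0,1\}^\ell$, $\binom{w}{u}$ denotes the number of sequences $1\le i_1<\dots<i_\ell\le n$ with $w[i_k]=u[k]$ for all $k$. The Cayley digraph $\Gamma(w)$ has vertex set $\mathbb Z/2n\mathbb Z$ and an edge from $v$ to $v+i$ for every vertex $v$ and every $i\in\{1,\dots,n\}$ with $w[i]=1$. An induced $u$-walk in $\Gamma(w)$ is a sequence of vertices $(v_1,\dots,v_{\ell+1})$ such that there are $1\le i_1<\dots<i_\ell\le n$ with $v_{k+1}\equiv v_k+i_k \pmod{2n}$ for all $k$, and such that, for each $k$, $(v_k,v_{k+1})$ is an edge of $\Gamma(w)$ if and only if $u[k]=1$. Then the following are equivalent (all asymptotics as $n\to\infty$): 1.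 (Uniformity) There are $\varepsilon_n\to0$ such that $w_n$ is $(d,\varepsilon_n)$-uniform for every $n$. 2. (Counting) For all $\ell\in\mathbb N$ and all $u\in\{0,1\}^\ell$, $\binom{w_n}{u}=d^{\|u\|_1}(1-d)^{\ell-\|u\|_1}\binom n\ell+o(n^\ell)$. 3. (Minimizer) For all $u\in\{0,1\}^3$, $\binom{w_n}{u}=d^{\|u\|_1}(1-d)^{3-\|u\|_1}\binom n3+o(n^3)$. 4. (Exponential sums) For every fixed $k\in\mathbb N$, $k\ne0$, $\frac1n\sum_{j=1}^n w_n[j]\exp\left(\frac{2\pi i}{n}kj\right)=o(1)$. 5. (Equidistribution) For every Lipschitz function $f:\mathbb R/\mathbb Z\to\mathbb C$, $\frac1n\sum_{j=1}^n w_n[j]\,f\left(\tfrac jn\right)=d\int_{\mathbb R/\mathbb Z}f+o(1)$. 6. (Cayley graph) For all $u\in\{0,1\}^3$, the number of induced $u$-walks in $\Gamma(w_n)$ is $d^{\|u\|_1}(1-d)^{3-\|u\|_1}\,2n\binom n3+o(n^4)$. -/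

import Mathlib

open Filter Topology Asymptotics MeasureTheory

/-- Binary words of length `n`. The `i`-th letter of `w`, with `i ∈ {1, …, n}`, is `w j` where
`j : Fin n` and `i = j + 1`. -/
abbrev BinWord (n : ℕ) : Type := Fin n → Fin 2

namespace BinWord

/-- The number `‖w‖₁` of 1-entries of `w`, as the sum of its letters. -/
def norm1 {n : ℕ} (w : BinWord n) : ℕ := ∑ j, (w j : ℕ)

/-- `w` is `(d, ε)`-uniform: every interval `I` of positions contains `d |I| ± ε n` ones. -/
def IsUniform {n : ℕ} (d ε : ℝ) (w : BinWord n) : Prop :=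
  ∀ a b : Fin n,
    |(∑ j ∈ Finset.Icc a b, ((w j : ℕ) : ℝ)) - d * ((Finset.Icc a b).card : ℝ)| ≤ ε * (n : ℝ)

/-- The number of subsequences of `w` equal to `u`: the number of increasing sequences of
positions `i_1 < … < i_ℓ` at which the letters of `w` spell `u`. -/
noncomputable def subseqCount {n ℓ : ℕ} (w : BinWord n) (u : BinWord ℓ) : ℕ :=
  Set.ncard {i : Fin ℓ → Fin n | StrictMono i ∧ ∀ k, w (i k) = u k}

/-- The probability `d ^ ‖u‖₁ (1 - d) ^ (ℓ - ‖u‖₁)` that a random word of length `ℓ` with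
independent letters, each equal to 1 with probability `d`, is `u`. (Always `‖u‖₁ ≤ ℓ`.) -/
noncomputable def prob {ℓ : ℕ} (d : ℝ) (u : BinWord ℓ) : ℝ :=
  d ^ u.norm1 * (1 - d) ^ (ℓ - u.norm1)

/-- The Cayley digraph of `w` on the vertex set `ℤ / 2n`: there is an edge from `v` to `v + i` for
every `i ∈ {1, …, n}` such that the `i`-th letter of `w` is 1. -/
def cayleyDigraph {n : ℕ} (w : BinWord n) : Digraph (ZMod (2 * n)) where
  Adj v v' := ∃ j : Fin n, w j = 1 ∧ v' = v + (((j : ℕ) + 1 : ℕ) : ZMod (2 * n))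

/-- The sequence of vertices `v_1, …, v_{ℓ+1}` is an induced `u`-walk in the Cayley digraph of `w`:
the steps `v_{k+1} - v_k` are represented modulo `2n` by `i_1 < … < i_ℓ` in `{1, …, n}`
(here `i_k` is `s k + 1`), and `(v_k, v_{k+1})` is an edge if and only if `u_k = 1`. -/
def IsInducedWalk {n ℓ : ℕ} (w : BinWord n) (u : BinWord ℓ) (v : Fin (ℓ + 1) → ZMod (2 * n)) :
    Prop :=
  (∃ s : Fin ℓ → Fin n, StrictMono s ∧
    ∀ k, v k.succ = v k.castSucc + (((s k : ℕ) + 1 : ℕ) : ZMod (2 * n))) ∧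
  ∀ k, w.cayleyDigraph.Adj (v k.castSucc) (v k.succ) ↔ u k = 1

/-- The number of induced `u`-walks in the Cayley digraph of `w`. -/
noncomputable def inducedWalkCount {n ℓ : ℕ} (w : BinWord n) (u : BinWord ℓ) : ℕ :=
  Set.ncard {v : Fin (ℓ + 1) → ZMod (2 * n) | w.IsInducedWalk u v}

end BinWord

/-! Every condition is compared with a single one, `SmallDisc`: the prefix discrepancies D_m, the
sums of w_j - d over j < m, are o(n) uniformly in m ≤ n. Uniformity is the same statement for
intervals, which are differences of prefixes.

From small discrepancy, Abel summation makes the sum of (w_j - d) b_j small for every b of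
controlled variation. This yields the counts (`abs_chainSum_sub_le`) and equidistribution
(`norm_sum_letter_sub_smul_le`).

Towards small discrepancy, D changes by at most 1 per step and D_0 = 0, so it suffices that the sum
of (D_m - μ)² is o(n³) for some constants μ (`smallDisc_of_sum_sq`). Counts of length three give
this with μ = 0: weighted by (u₁ - d)(u₂ - d) their main terms cancel, and what is left is half the
sum of D_k², up to O(n²) (`sum_sq_disc_le`). Exponential sums give it with μ a mean: the variance of
the partial sums is, up to terms containing the total D_n, a quadratic form whose kernel is the
periodic Bernoulli function B₂ (`variance_partialSum`). Its Fourier coefficients decay like 1/k², so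
decay at each fixed frequency is enough; the density hypothesis disposes of D_n.

Characters are Lipschitz with mean zero, which links equidistribution to exponential sums. A walk in
the Cayley digraph is a free starting vertex together with a subsequence (`inducedWalkCount_eq`). -/

namespace BinWord

/-! ### Letters and prefix discrepancies -/

/-- The letter of `w` at the `0`-based position `j`, as a real number, extended by `0`. -/
noncomputable def letter {n : ℕ} (w : BinWord n) (j : ℕ) : ℝ :=
  if h : j < n then ((w ⟨j, h⟩ : ℕ) : ℝ) else 0

/-- The discrepancy of the prefix of length `m`. -/
noncomputable def disc {n : ℕ} (d : ℝ) (w : BinWord n) (m : ℕ) : ℝ :=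
  ∑ j ∈ Finset.range m, (w.letter j - d)

/-- The indicator of the letter `c` at position `j`, as an affine function of the letter. -/
noncomputable def ind {n : ℕ} (w : BinWord n) (c : Fin 2) (j : ℕ) : ℝ :=
  if c = 1 then w.letter j else 1 - w.letter j

lemma letter_fin {n : ℕ} (w : BinWord n) (j : Fin n) : w.letter j = ((w j : ℕ) : ℝ) := by
  simp [letter]

lemma letter_eq_zero_or_one {n : ℕ} (w : BinWord n) (j : ℕ) : w.letter j = 0 ∨ w.letter j = 1 := by
  unfold letter
  split_ifs with h
  · generalize w ⟨j, h⟩ = c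
    fin_cases c <;> simp
  · simp

lemma letter_nonneg {n : ℕ} (w : BinWord n) (j : ℕ) : 0 ≤ w.letter j := by
  rcases w.letter_eq_zero_or_one j with h | h <;> simp [h]

lemma letter_le_one {n : ℕ} (w : BinWord n) (j : ℕ) : w.letter j ≤ 1 := by
  rcases w.letter_eq_zero_or_one j with h | h <;> simp [h]

lemma abs_letter_sub_le_one {n : ℕ} {d : ℝ} (hd0 : 0 ≤ d) (hd1 : d ≤ 1) (w : BinWord n) (j : ℕ) :
    |w.letter j - d| ≤ 1 := by
  have := w.letter_nonneg j
  have := w.letter_le_one j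
  exact abs_le.2 ⟨by linarith, by linarith⟩

lemma ind_fin {n : ℕ} (w : BinWord n) (c : Fin 2) (j : Fin n) :
    w.ind c j = if w j = c then 1 else 0 := by
  unfold ind
  rw [letter_fin]
  generalize w j = b
  fin_cases b <;> fin_cases c <;> simp

lemma abs_ind_le_one {n : ℕ} (w : BinWord n) (c : Fin 2) (j : ℕ) : |w.ind c j| ≤ 1 := by
  unfold ind
  rcases w.letter_eq_zero_or_one j with h | h <;> split_ifs <;> simp [h]

@[simp] lemma disc_zero {n : ℕ} (d : ℝ) (w : BinWord n) : w.disc d 0 = 0 := by simp [disc]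

lemma disc_succ {n : ℕ} (d : ℝ) (w : BinWord n) (m : ℕ) :
    w.disc d (m + 1) = w.disc d m + (w.letter m - d) := by
  rw [disc, Finset.sum_range_succ, disc]

lemma sum_letter {n : ℕ} (w : BinWord n) : ∑ j ∈ Finset.range n, w.letter j = (w.norm1 : ℝ) := by
  rw [Finset.sum_range]
  simp [norm1, letter_fin]

lemma disc_self {n : ℕ} (d : ℝ) (w : BinWord n) : w.disc d n = (w.norm1 : ℝ) - d * n := by
  simp [disc, sum_letter, mul_comm]

lemma sum_Icc_letter {n : ℕ} (d : ℝ) (w : BinWord n) (a b : Fin n) (hab : a ≤ b) :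
    (∑ j ∈ Finset.Icc a b, ((w j : ℕ) : ℝ)) - d * ((Finset.Icc a b).card : ℝ)
      = w.disc d (b + 1) - w.disc d a := by
  have h1 : ∑ j ∈ Finset.Icc a b, (w.letter j - d)
      = ∑ j ∈ Finset.Ico (a : ℕ) (b + 1), (w.letter j - d) := by
    have h : Finset.Ico (a : ℕ) (b + 1) = (Finset.Icc a b).map Fin.valEmbedding := by
      rw [Fin.map_valEmbedding_Icc]
      rfl
    rw [h, Finset.sum_map]
    rfl
  have hab' : (a : ℕ) ≤ b + 1 := by
    have : (a : ℕ) ≤ b := hab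
    omega
  rw [disc, disc, ← Finset.sum_Ico_eq_sub _ hab', ← h1, Finset.sum_sub_distrib]
  simp [letter_fin, mul_comm]

end BinWord

/-! ### Sums over increasing chains -/

/-- Weighted sums over increasing chains `i_1 < ⋯ < i_ℓ < m`, defined by recursion on the last
element of the chain. -/
noncomputable def chainSum : (ℓ : ℕ) → (Fin ℓ → ℕ → ℝ) → ℕ → ℝ
  | 0, _, _ => 1
  | ℓ + 1, φ, m => ∑ j ∈ Finset.range m, φ (Fin.last ℓ) j * chainSum ℓ (fun k => φ k.castSucc) j

lemma Fin.strictMono_snoc_iff {ℓ n : ℕ} (i : Fin ℓ → Fin n) (j : Fin n) :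
    StrictMono (Fin.snoc (α := fun _ => Fin n) i j) ↔ StrictMono i ∧ ∀ k, i k < j := by
  constructor
  · intro h
    refine ⟨fun a b hab => ?_, fun k => ?_⟩
    · simpa using h (Fin.castSucc_lt_castSucc_iff.2 hab)
    · simpa using h (Fin.castSucc_lt_last k)
  · rintro ⟨h, h'⟩ a b
    induction a using Fin.lastCases with
    | last => intro hab; exact absurd hab (not_lt.2 (Fin.le_last b))
    | cast a =>
      induction b using Fin.lastCases with
      | last => intro _; simpa using h' a
      | cast b => intro hab; simpa using h (Fin.castSucc_lt_castSucc_iff.1 hab)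

-- Splitting off the last entry j of a chain leaves a chain below j, which is the recursion of
-- `chainSum`.
open Classical in
lemma chainSum_eq_sum {n : ℕ} (ℓ : ℕ) (φ : Fin ℓ → ℕ → ℝ) (m : ℕ) (hm : m ≤ n) :
    chainSum ℓ φ m = ∑ i : Fin ℓ → Fin n,
      if StrictMono i ∧ ∀ k, (i k : ℕ) < m then ∏ k, φ k (i k) else 0 := by
  induction ℓ generalizing m with
  | zero =>
    have h : StrictMono (default : Fin 0 → Fin n) := fun a => a.elim0
    rw [Fintype.sum_unique, if_pos ⟨h, fun k => k.elim0⟩]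
    simp [chainSum]
  | succ ℓ ih =>
    rw [chainSum, ← (Fin.snocEquiv (fun _ : Fin (ℓ + 1) => Fin n)).sum_comp, Fintype.sum_prod_type]
    have h1 : ∀ j : Fin n, (∑ i : Fin ℓ → Fin n,
        if StrictMono (Fin.snocEquiv (fun _ : Fin (ℓ + 1) => Fin n) (j, i)) ∧
          ∀ k, ((Fin.snocEquiv (fun _ : Fin (ℓ + 1) => Fin n) (j, i) k : Fin n) : ℕ) < m then
          ∏ k, φ k (Fin.snocEquiv (fun _ : Fin (ℓ + 1) => Fin n) (j, i) k : Fin n) else 0)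
        = if (j : ℕ) < m then φ (Fin.last ℓ) j * chainSum ℓ (fun k => φ k.castSucc) j else 0 := by
      intro j
      rw [ih _ _ j.2.le]
      split_ifs with hj
      · rw [Finset.mul_sum]
        refine Finset.sum_congr rfl fun i _ => ?_
        have : (StrictMono (Fin.snocEquiv (fun _ : Fin (ℓ + 1) => Fin n) (j, i)) ∧
          ∀ k, ((Fin.snocEquiv (fun _ : Fin (ℓ + 1) => Fin n) (j, i) k : Fin n) : ℕ) < m) ↔
          (StrictMono i ∧ ∀ k, (i k : ℕ) < j) := by
          change (StrictMono (Fin.snoc (α := fun _ => Fin n) i j) ∧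
            ∀ k, ((Fin.snoc (α := fun _ => Fin n) i j k : Fin n) : ℕ) < m) ↔ _
          rw [Fin.strictMono_snoc_iff, Fin.forall_fin_succ']
          simp only [Fin.snoc_castSucc, Fin.snoc_last, Fin.lt_def]
          exact ⟨fun h => h.1, fun h => ⟨h, fun k => (h.2 k).trans hj, hj⟩⟩
        simp only [this]
        split_ifs
        · simp [Fin.prod_univ_castSucc, mul_comm]
        · simp
      · refine Finset.sum_eq_zero fun i _ => if_neg ?_
        rintro ⟨-, h⟩
        exact hj (by simpa using h (Fin.last ℓ))
    rw [Finset.sum_congr rfl fun j _ => h1 j]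
    rw [← Finset.sum_range (n := n)
      (fun j => if j < m then φ (Fin.last ℓ) j * chainSum ℓ (fun k => φ k.castSucc) j else 0)]
    rw [← Finset.sum_filter]
    congr 1
    ext j
    simp
    omega

namespace BinWord

lemma subseqCount_eq_chainSum {n ℓ : ℕ} (w : BinWord n) (u : BinWord ℓ) :
    (w.subseqCount u : ℝ) = chainSum ℓ (fun k => w.ind (u k)) n := by
  classical
  rw [chainSum_eq_sum (n := n) _ _ _ le_rfl, subseqCount, Set.ncard_eq_toFinset_card']
  rw [Set.toFinset_ofPred, Finset.natCast_card_filter]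
  refine Finset.sum_congr rfl fun i _ => ?_
  simp only [ind_fin, Finset.prod_boole, ← ite_and]
  simp

end BinWord

/-! ### Abel summation -/

lemma norm_sum_smul_le_of_abs_sum_le {E : Type*} [NormedAddCommGroup E] [NormedSpace ℝ E]
    (g : ℕ → ℝ) (b : ℕ → E) (m : ℕ) (δ : ℝ)
    (hG : ∀ k ≤ m, |∑ j ∈ Finset.range k, g j| ≤ δ) :
    ‖∑ j ∈ Finset.range m, g j • b j‖
      ≤ δ * (‖b m‖ + ∑ j ∈ Finset.range m, ‖b (j + 1) - b j‖) := by
  have abel : ∀ k, ∑ j ∈ Finset.range k, g j • b j = (∑ j ∈ Finset.range k, g j) • b k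
      - ∑ j ∈ Finset.range k, (∑ i ∈ Finset.range (j + 1), g i) • (b (j + 1) - b j) := by
    intro k
    induction k with
    | zero => simp
    | succ k ih =>
      rw [Finset.sum_range_succ, ih, Finset.sum_range_succ (fun j => _ • _),
        Finset.sum_range_succ g k]
      module
  rw [abel, mul_add, Finset.mul_sum]
  refine (norm_sub_le _ _).trans (add_le_add ?_ ((norm_sum_le _ _).trans ?_))
  · rw [norm_smul]
    exact mul_le_mul_of_nonneg_right (hG m le_rfl) (norm_nonneg _)
  · refine Finset.sum_le_sum fun j hj => ?_
    rw [norm_smul]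
    exact mul_le_mul_of_nonneg_right (hG _ (Finset.mem_range.1 hj)) (norm_nonneg _)

/-- For monotone b the variation telescopes to b m - b 0, so the general bound becomes δ (2 b m - b
0). -/
lemma abs_sum_mul_le_of_monotone (g b : ℕ → ℝ) (hb : Monotone b) (hb0 : 0 ≤ b 0) (m : ℕ) (δ : ℝ)
    (hG : ∀ k ≤ m, |∑ j ∈ Finset.range k, g j| ≤ δ) :
    |∑ j ∈ Finset.range m, g j * b j| ≤ 2 * δ * b m := by
  have h := norm_sum_smul_le_of_abs_sum_le g b m δ hG
  have hδ : 0 ≤ δ := (abs_nonneg _).trans (hG m le_rfl)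
  have h1 : ∑ j ∈ Finset.range m, ‖b (j + 1) - b j‖ = b m - b 0 := by
    rw [← Finset.sum_range_sub]
    refine Finset.sum_congr rfl fun j _ => ?_
    rw [Real.norm_eq_abs, abs_of_nonneg (sub_nonneg.2 (hb (Nat.le_succ j)))]
  have h2 : ‖b m‖ = b m := by
    rw [Real.norm_eq_abs, abs_of_nonneg (hb0.trans (hb (Nat.zero_le m)))]
  rw [h1, h2] at h
  simp only [smul_eq_mul, Real.norm_eq_abs] at h
  nlinarith [mul_nonneg hδ hb0]

/-! ### Small discrepancy implies the subsequence counts -/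

namespace BinWord

lemma prob_eq_prod {ℓ : ℕ} (d : ℝ) (u : BinWord ℓ) :
    u.prob d = ∏ k, if u k = 1 then d else 1 - d := by
  have h1 : u.norm1 = (Finset.univ.filter fun k => u k = 1).card := by
    rw [norm1, Finset.card_filter]
    refine Finset.sum_congr rfl fun k _ => ?_
    generalize u k = c
    fin_cases c <;> simp
  have h2 : ℓ - u.norm1 = (Finset.univ.filter fun k => ¬ u k = 1).card := by
    have := Finset.card_filter_add_card_filter_not (s := Finset.univ) (fun k => u k = 1)
    simp only [Finset.card_univ, Fintype.card_fin] at this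
    omega
  rw [prob, h2, h1, Finset.prod_ite, Finset.prod_const, Finset.prod_const]

lemma prob_nonneg {ℓ : ℕ} {d : ℝ} (hd0 : 0 ≤ d) (hd1 : d ≤ 1) (u : BinWord ℓ) : 0 ≤ u.prob d :=
  mul_nonneg (pow_nonneg hd0 _) (pow_nonneg (sub_nonneg.2 hd1) _)

lemma prob_le_one {ℓ : ℕ} {d : ℝ} (hd0 : 0 ≤ d) (hd1 : d ≤ 1) (u : BinWord ℓ) : u.prob d ≤ 1 :=
  mul_le_one₀ (pow_le_one₀ hd0 hd1) (pow_nonneg (sub_nonneg.2 hd1) _)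
    (pow_le_one₀ (sub_nonneg.2 hd1) (by linarith))

lemma abs_sum_ind_sub_le {n : ℕ} (d : ℝ) (w : BinWord n) (c : Fin 2) (k : ℕ) :
    |∑ j ∈ Finset.range k, (w.ind c j - if c = 1 then d else 1 - d)| = |w.disc d k| := by
  unfold ind disc
  split_ifs
  · rfl
  · rw [← abs_neg, ← Finset.sum_neg_distrib]
    congr 1
    exact Finset.sum_congr rfl fun j _ => by ring

/-- Induction on the last letter. Replacing the count of the shorter word by its main term costs the
inductive error n times; replacing the last letter by its density costs 2εn · n^ℓ by Abel summation
against the monotone weight `j.choose ℓ`. -/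
lemma abs_chainSum_sub_le {n : ℕ} {d : ℝ} (hd0 : 0 ≤ d) (hd1 : d ≤ 1) (w : BinWord n) {ε : ℝ}
    (hε : 0 ≤ ε) (h : ∀ m ≤ n, |w.disc d m| ≤ ε * n) (ℓ : ℕ) (u : BinWord ℓ) (m : ℕ) (hm : m ≤ n) :
    |chainSum ℓ (fun k => w.ind (u k)) m - u.prob d * (m.choose ℓ : ℝ)|
      ≤ 2 * ℓ * ε * (n : ℝ) ^ ℓ := by
  induction ℓ generalizing m with
  | zero => simp [chainSum, prob, norm1]
  | succ ℓ ih =>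
    set v : BinWord ℓ := fun k => u k.castSucc with hv
    set c := u (Fin.last ℓ) with hc
    set q : ℝ := if c = 1 then d else 1 - d with hq
    have hp : u.prob d = v.prob d * q := by
      rw [prob_eq_prod, prob_eq_prod, Fin.prod_univ_castSucc]
    have hch : (m.choose (ℓ + 1) : ℝ) = ∑ j ∈ Finset.range m, (j.choose ℓ : ℝ) := by
      clear hm
      induction m with
      | zero => simp
      | succ m ihm => rw [Finset.sum_range_succ, ← ihm, Nat.choose_succ_succ, Nat.cast_add, add_comm]
    have key : chainSum (ℓ + 1) (fun k => w.ind (u k)) m - u.prob d * (m.choose (ℓ + 1) : ℝ)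
        = ∑ j ∈ Finset.range m, w.ind c j *
            (chainSum ℓ (fun k => w.ind (v k)) j - v.prob d * (j.choose ℓ : ℝ))
          + v.prob d * ∑ j ∈ Finset.range m, (w.ind c j - q) * (j.choose ℓ : ℝ) := by
      rw [chainSum, hp, hch, Finset.mul_sum, Finset.mul_sum, ← Finset.sum_sub_distrib,
        ← Finset.sum_add_distrib]
      exact Finset.sum_congr rfl fun j _ => by ring
    have b1 : |∑ j ∈ Finset.range m, w.ind c j *
            (chainSum ℓ (fun k => w.ind (v k)) j - v.prob d * (j.choose ℓ : ℝ))|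
          ≤ n * (2 * ℓ * ε * (n : ℝ) ^ ℓ) := by
      refine (Finset.abs_sum_le_sum_abs _ _).trans ?_
      refine (Finset.sum_le_card_nsmul _ _ (2 * ℓ * ε * (n : ℝ) ^ ℓ) fun j hj => ?_).trans ?_
      · rw [abs_mul]
        refine (mul_le_of_le_one_left (abs_nonneg _) (w.abs_ind_le_one c j)).trans ?_
        exact ih v j ((Finset.mem_range.1 hj).le.trans hm)
      · rw [Finset.card_range, nsmul_eq_mul]
        gcongr
    have b2 : |∑ j ∈ Finset.range m, (w.ind c j - q) * (j.choose ℓ : ℝ)|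
        ≤ 2 * (ε * n) * (m.choose ℓ : ℝ) := by
      refine abs_sum_mul_le_of_monotone _ (fun j => (j.choose ℓ : ℝ)) ?_ (Nat.cast_nonneg _) m _ ?_
      · exact fun a b hab => Nat.cast_le.2 (Nat.choose_le_choose ℓ hab)
      · exact fun k hk => (abs_sum_ind_sub_le d w c k).trans_le (h k (hk.trans hm))
    have b3 : (m.choose ℓ : ℝ) ≤ (n : ℝ) ^ ℓ := by
      have : m.choose ℓ ≤ n ^ ℓ := (Nat.choose_le_pow m ℓ).trans (Nat.pow_le_pow_left hm ℓ)
      exact_mod_cast this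
    have b4 : |v.prob d * ∑ j ∈ Finset.range m, (w.ind c j - q) * (j.choose ℓ : ℝ)|
        ≤ 2 * (ε * n) * (n : ℝ) ^ ℓ := by
      rw [abs_mul, abs_of_nonneg (v.prob_nonneg hd0 hd1)]
      refine (mul_le_of_le_one_left (abs_nonneg _) (v.prob_le_one hd0 hd1)).trans (b2.trans ?_)
      gcongr
    rw [key]
    refine (abs_add_le _ _).trans ((add_le_add b1 b4).trans (le_of_eq ?_))
    push_cast
    ring

/-- The prefix discrepancies of `w n` are `o(n)`, uniformly in the prefix. -/
def SmallDisc (d : ℝ) (w : (n : ℕ) → BinWord n) : Prop :=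
  ∀ ε > 0, ∀ᶠ n in atTop, ∀ m ≤ n, |(w n).disc d m| ≤ ε * n

lemma SmallDisc.subseqCount_isLittleO {d : ℝ} (hd0 : 0 ≤ d) (hd1 : d ≤ 1)
    {w : (n : ℕ) → BinWord n} (h : SmallDisc d w) (ℓ : ℕ) (u : BinWord ℓ) :
    (fun n : ℕ => ((w n).subseqCount u : ℝ) - u.prob d * (n.choose ℓ : ℝ))
      =o[atTop] (fun n : ℕ => (n : ℝ) ^ ℓ) := by
  rw [isLittleO_iff]
  intro c hc
  -- The error is 2ℓ times this constant; the added 1 covers ℓ = 0.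
  filter_upwards [h (c / (2 * ℓ + 1)) (by positivity)] with n hn
  have := abs_chainSum_sub_le hd0 hd1 (w n) (by positivity) hn ℓ u n le_rfl
  rw [subseqCount_eq_chainSum, Real.norm_eq_abs, Real.norm_of_nonneg (by positivity)]
  refine this.trans ?_
  gcongr
  rw [mul_div_assoc', div_le_iff₀ (by positivity)]
  nlinarith

/-! ### Uniformity and prefix discrepancies -/

lemma exists_isUniform_iff_smallDisc {d : ℝ} {w : (n : ℕ) → BinWord n} :
    (∃ ε : ℕ → ℝ, Tendsto ε atTop (𝓝 0) ∧ ∀ n, (w n).IsUniform d (ε n)) ↔ SmallDisc d w := by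
  constructor
  · rintro ⟨ε, hε, h⟩ c hc
    filter_upwards [hε.eventually_lt_const hc] with n hn m hm
    rcases Nat.eq_zero_or_pos m with rfl | hm0
    · simpa using mul_nonneg hc.le (Nat.cast_nonneg n)
    · have h1 := h n ⟨0, hm0.trans_le hm⟩ ⟨m - 1, by omega⟩
      rw [sum_Icc_letter _ _ _ _ (by simp [Fin.le_def])] at h1
      simp only [disc_zero, sub_zero, Nat.sub_add_cancel hm0] at h1
      exact h1.trans (by gcongr)
  · intro h
    set M : ℕ → ℝ := fun n =>
      (Finset.range (n + 1)).sup' Finset.nonempty_range_add_one fun m => |(w n).disc d m| with hM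
    have hle : ∀ n m, m ≤ n → |(w n).disc d m| ≤ M n := fun n m hm =>
      Finset.le_sup' (fun m => |(w n).disc d m|) (Finset.mem_range.2 (Nat.lt_succ_of_le hm))
    have hM0 : ∀ n, 0 ≤ M n := fun n => (abs_nonneg _).trans (hle n 0 (Nat.zero_le n))
    -- The factor 2 appears because an interval is a difference of two prefixes.
    refine ⟨fun n => 2 * (M n / n), ?_, fun n a b => ?_⟩
    · rw [← mul_zero (2 : ℝ)]
      refine Tendsto.const_mul 2 (Metric.tendsto_atTop'.2 fun c hc => ?_)
      obtain ⟨N, hN⟩ := eventually_atTop.1 (h (c / 2) (half_pos hc))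
      refine ⟨N, fun n hn => ?_⟩
      have hn0 : (0 : ℝ) < n := Nat.cast_pos.2 (by omega)
      have h2 : M n ≤ c / 2 * n := Finset.sup'_le _ _ fun m hm =>
        hN n hn.le m (Nat.le_of_lt_succ (Finset.mem_range.1 hm))
      rw [Real.dist_eq, sub_zero, abs_of_nonneg (div_nonneg (hM0 n) hn0.le), div_lt_iff₀ hn0]
      nlinarith
    · have hn0 : (n : ℝ) ≠ 0 := Nat.cast_ne_zero.2 (by have := a.2; omega)
      have e : 2 * (M n / n) * n = 2 * M n := by field_simp
      rw [e]
      rcases le_or_gt a b with hab | hab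
      · rw [sum_Icc_letter _ _ _ _ hab]
        have h1 := hle n (b + 1) b.2
        have h2 := hle n a a.2.le
        exact (abs_sub _ _).trans (by linarith)
      · rw [Finset.Icc_eq_empty (not_le.2 hab)]
        simpa using hM0 n

end BinWord

/-! ### Counts of length three imply small discrepancy -/

lemma abs_sub_pow_three_le (x y : ℝ) : |x - y| ^ 3 ≤ 4 * |x ^ 3 - y ^ 3| := by
  have h : x ^ 3 - y ^ 3 = (x - y) * (x ^ 2 + x * y + y ^ 2) := by ring
  rw [h, abs_mul, pow_succ', sq_abs]
  -- The difference of the two sides, without the absolute value, is 3 (x + y)².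
  have h1 : (x - y) ^ 2 ≤ 4 * |x ^ 2 + x * y + y ^ 2| :=
    le_trans (by nlinarith [sq_nonneg (x + y)]) (mul_le_mul_of_nonneg_left (le_abs_self _) (by norm_num))
  nlinarith [abs_nonneg (x - y)]

/-- A sequence with steps at most 1 cannot travel far without a large square sum. One step changes
(a - μ)³ by at most 3/2 times the sum of the two adjacent squares; telescoping gives the factor 3
and `abs_sub_pow_three_le` another 4. -/
lemma abs_sub_pow_three_le_sum {a : ℕ → ℝ} (ha : ∀ m, |a (m + 1) - a m| ≤ 1) (μ : ℝ) {q n : ℕ}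
    (hq : q < n) : |a q - a 0| ^ 3 ≤ 12 * ∑ m ∈ Finset.range n, (a m - μ) ^ 2 := by
  have step : ∀ m, |(a (m + 1) - μ) ^ 3 - (a m - μ) ^ 3|
      ≤ 3 / 2 * (a m - μ) ^ 2 + 3 / 2 * (a (m + 1) - μ) ^ 2 := by
    intro m
    have e : (a (m + 1) - μ) ^ 3 - (a m - μ) ^ 3 = (a (m + 1) - a m) *
        ((a (m + 1) - μ) ^ 2 + (a (m + 1) - μ) * (a m - μ) + (a m - μ) ^ 2) := by ring
    rw [e, abs_mul]
    refine (mul_le_of_le_one_left (abs_nonneg _) (ha m)).trans (abs_le.2 ⟨?_, ?_⟩) <;>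
      nlinarith [sq_nonneg (a (m + 1) - μ + (a m - μ)), sq_nonneg (a (m + 1) - μ - (a m - μ)),
        sq_nonneg (a (m + 1) - μ), sq_nonneg (a m - μ)]
  have h : ∀ q, |(a q - μ) ^ 3 - (a 0 - μ) ^ 3|
      ≤ 3 * ∑ m ∈ Finset.range q, (a m - μ) ^ 2 + 3 / 2 * (a q - μ) ^ 2 := by
    intro q
    induction q with
    | zero => simp; positivity
    | succ q ih =>
      rw [Finset.sum_range_succ]
      have := abs_sub_le ((a (q + 1) - μ) ^ 3) ((a q - μ) ^ 3) ((a 0 - μ) ^ 3)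
      linarith [step q]
  have h1 : ∑ m ∈ Finset.range (q + 1), (a m - μ) ^ 2 ≤ ∑ m ∈ Finset.range n, (a m - μ) ^ 2 :=
    Finset.sum_le_sum_of_subset_of_nonneg (Finset.range_mono hq) fun _ _ _ => sq_nonneg _
  rw [Finset.sum_range_succ] at h1
  have h2 := abs_sub_pow_three_le (a q - μ) (a 0 - μ)
  rw [sub_sub_sub_cancel_right] at h2
  nlinarith [h q, sq_nonneg (a q - μ)]

namespace BinWord

lemma abs_disc_succ_sub_le_one {n : ℕ} {d : ℝ} (hd0 : 0 ≤ d) (hd1 : d ≤ 1) (w : BinWord n) (m : ℕ) :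
    |w.disc d (m + 1) - w.disc d m| ≤ 1 := by
  rw [disc_succ, add_sub_cancel_left]
  exact abs_letter_sub_le_one hd0 hd1 w m

lemma smallDisc_of_sum_sq {d : ℝ} (hd0 : 0 ≤ d) (hd1 : d ≤ 1) {w : (n : ℕ) → BinWord n}
    (h : ∀ ε > 0, ∀ᶠ n : ℕ in atTop,
      ∃ μ, ∑ m ∈ Finset.range n, ((w n).disc d m - μ) ^ 2 ≤ ε * (n : ℝ) ^ 3) :
    SmallDisc d w := by
  intro ε hε
  filter_upwards [h ((ε / 2) ^ 3 / 12) (by positivity), eventually_gt_atTop 0,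
    tendsto_natCast_atTop_atTop.eventually_ge_atTop (2 / ε)] with n ⟨μ, hμ⟩ hn0 hn m hm
  have hlt : ∀ q < n, |(w n).disc d q| ≤ ε / 2 * n := by
    intro q hq
    have := abs_sub_pow_three_le_sum (abs_disc_succ_sub_le_one hd0 hd1 (w n)) μ hq
    rw [disc_zero, sub_zero] at this
    refine le_of_pow_le_pow_left₀ three_ne_zero (by positivity) (this.trans ?_)
    rw [mul_pow]
    linarith
  have hn' : 1 ≤ ε / 2 * n := by
    rw [div_le_iff₀ hε] at hn
    linarith
  rcases hm.lt_or_eq with hm | rfl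
  · exact (hlt m hm).trans (by linarith)
  -- The square sum stops at n - 1, so the full prefix is reached by one further step, of size at
  -- most 1 ≤ (ε / 2) n.
  · obtain ⟨k, rfl⟩ := Nat.exists_eq_succ_of_ne_zero hn0.ne'
    have h1 := hlt k (Nat.lt_succ_self k)
    have h2 := abs_disc_succ_sub_le_one hd0 hd1 (w (k + 1)) k
    have h3 := abs_sub_abs_le_abs_sub ((w (k + 1)).disc d (k + 1)) ((w (k + 1)).disc d k)
    simp only [Nat.succ_eq_add_one] at *
    linarith

/-- The centred weight `(u₁ - d) (u₂ - d)` of a word of length three. -/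
noncomputable def pairWeight (d : ℝ) (u : BinWord 3) : ℝ :=
  (((u 0 : ℕ) : ℝ) - d) * (((u 1 : ℕ) : ℝ) - d)

/-- Under independent letters of density d, this is the expectation of a product of centred letters;
it factors over the coordinates and each centred factor has mean zero. -/
lemma sum_pairWeight_mul_prob (d : ℝ) : ∑ u : BinWord 3, pairWeight d u * u.prob d = 0 := by
  have h : ∀ u : BinWord 3, pairWeight d u * u.prob d
      = ∏ k, (![fun c : Fin 2 => (((c : ℕ) : ℝ) - d) * (if c = 1 then d else 1 - d),
          fun c : Fin 2 => (((c : ℕ) : ℝ) - d) * (if c = 1 then d else 1 - d),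
          fun c : Fin 2 => if c = 1 then d else 1 - d] k) (u k) := by
    intro u
    rw [pairWeight, prob_eq_prod, Fin.prod_univ_three, Fin.prod_univ_three]
    simp only [Matrix.cons_val_zero, Matrix.cons_val_one, Matrix.cons_val]
    ring
  rw [Finset.sum_congr rfl fun u _ => h u, ← Fintype.prod_sum, Fin.prod_univ_three]
  simp
  ring

/-- Each increasing triple i is counted by exactly one word, u = w ∘ i, so the weight is evaluated
at the letters of w itself. -/
lemma sum_pairWeight_mul_subseqCount {n : ℕ} (d : ℝ) (w : BinWord n) :
    ∑ u : BinWord 3, pairWeight d u * (w.subseqCount u : ℝ)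
      = chainSum 3 ![fun j => w.letter j - d, fun j => w.letter j - d, fun _ => 1] n := by
  classical
  have h1 : ∀ u : BinWord 3, (w.subseqCount u : ℝ)
      = ∑ i : Fin 3 → Fin n, if StrictMono i ∧ u = w ∘ i then (1 : ℝ) else 0 := by
    intro u
    rw [subseqCount, Set.ncard_eq_toFinset_card', Set.toFinset_ofPred, Finset.natCast_card_filter]
    refine Finset.sum_congr rfl fun i _ => ?_
    simp only [funext_iff, Function.comp_apply, eq_comm]
  rw [chainSum_eq_sum (n := n) _ _ _ le_rfl]
  simp only [h1, Finset.mul_sum]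
  rw [Finset.sum_comm]
  refine Finset.sum_congr rfl fun i _ => ?_
  by_cases hi : StrictMono i
  · simp [hi, pairWeight, Fin.prod_univ_three, letter_fin]
  · simp [hi]

/-- For a fixed third index k, twice the sum over pairs below k is the square of the sum minus the
diagonal. -/
lemma two_mul_chainSum_pair {n : ℕ} (d : ℝ) (w : BinWord n) :
    2 * chainSum 3 ![fun j => w.letter j - d, fun j => w.letter j - d, fun _ => 1] n
      = ∑ k ∈ Finset.range n,
          (w.disc d k ^ 2 - ∑ j ∈ Finset.range k, (w.letter j - d) ^ 2) := by
  have h : ∀ k, w.disc d k ^ 2 - ∑ j ∈ Finset.range k, (w.letter j - d) ^ 2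
      = 2 * ∑ j ∈ Finset.range k, (w.letter j - d) * w.disc d j := by
    intro k
    induction k with
    | zero => simp
    | succ k ih =>
      rw [Finset.sum_range_succ, Finset.sum_range_succ, disc_succ, mul_add, ← ih]
      ring
  rw [Finset.sum_congr rfl fun k _ => h k, ← Finset.mul_sum]
  congr 1
  simp only [chainSum, disc]
  refine Finset.sum_congr rfl fun k _ => ?_
  simp [Fin.last, Fin.castSucc]

lemma sum_sq_disc_le {n : ℕ} {d : ℝ} (hd0 : 0 ≤ d) (hd1 : d ≤ 1) (w : BinWord n) :
    ∑ m ∈ Finset.range n, w.disc d m ^ 2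
      ≤ 2 * (∑ u : BinWord 3, |(w.subseqCount u : ℝ) - u.prob d * (n.choose 3 : ℝ)|) + n ^ 2 := by
  have h1 : chainSum 3 ![fun j => w.letter j - d, fun j => w.letter j - d, fun _ => 1] n
      = ∑ u : BinWord 3, pairWeight d u * ((w.subseqCount u : ℝ) - u.prob d * (n.choose 3 : ℝ)) := by
    simp only [mul_sub, Finset.sum_sub_distrib, ← mul_assoc]
    rw [← Finset.sum_mul, sum_pairWeight_mul_prob, sum_pairWeight_mul_subseqCount]
    ring
  have hc : ∀ c : Fin 2, |((c : ℕ) : ℝ) - d| ≤ 1 := by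
    intro c
    fin_cases c <;> simp [abs_le] <;> constructor <;> linarith
  have h2 : chainSum 3 ![fun j => w.letter j - d, fun j => w.letter j - d, fun _ => 1] n
      ≤ ∑ u : BinWord 3, |(w.subseqCount u : ℝ) - u.prob d * (n.choose 3 : ℝ)| := by
    rw [h1]
    refine Finset.sum_le_sum fun u _ => (le_abs_self _).trans ?_
    rw [abs_mul]
    refine mul_le_of_le_one_left (abs_nonneg _) ?_
    rw [pairWeight, abs_mul]
    exact mul_le_one₀ (hc _) (abs_nonneg _) (hc _)
  have h3 := two_mul_chainSum_pair d w
  rw [Finset.sum_sub_distrib] at h3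
  have h4 : ∑ k ∈ Finset.range n, ∑ j ∈ Finset.range k, (w.letter j - d) ^ 2 ≤ (n : ℝ) ^ 2 := by
    have : ∀ k ∈ Finset.range n, ∑ j ∈ Finset.range k, (w.letter j - d) ^ 2 ≤ (n : ℝ) := by
      intro k hk
      refine (Finset.sum_le_card_nsmul _ _ 1 fun j _ =>
        (sq_le_one_iff_abs_le_one _).2 (abs_letter_sub_le_one hd0 hd1 w j)).trans ?_
      simpa using (Finset.mem_range.1 hk).le
    refine (Finset.sum_le_card_nsmul _ _ _ this).trans ?_
    simp [sq]
  linarith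

lemma smallDisc_of_subseqCount_three {d : ℝ} (hd0 : 0 ≤ d) (hd1 : d ≤ 1) {w : (n : ℕ) → BinWord n}
    (h : ∀ u : BinWord 3,
      (fun n : ℕ => ((w n).subseqCount u : ℝ) - u.prob d * (n.choose 3 : ℝ))
        =o[atTop] (fun n : ℕ => (n : ℝ) ^ 3)) :
    SmallDisc d w := by
  refine smallDisc_of_sum_sq hd0 hd1 fun ε hε => ?_
  have hsum : (fun n : ℕ => ∑ u : BinWord 3,
      |((w n).subseqCount u : ℝ) - u.prob d * (n.choose 3 : ℝ)|)
        =o[atTop] (fun n : ℕ => (n : ℝ) ^ 3) := IsLittleO.fun_sum fun u _ => (h u).abs_left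
  have hε4 : (0 : ℝ) < ε / 4 := by positivity
  filter_upwards [hsum.def hε4, tendsto_natCast_atTop_atTop.eventually_ge_atTop (2 / ε)] with n h1 h2
  refine ⟨0, ?_⟩
  simp only [sub_zero]
  refine (sum_sq_disc_le hd0 hd1 (w n)).trans ?_
  have h3 := (le_abs_self _).trans h1
  rw [Real.norm_of_nonneg (by positivity)] at h3
  rw [div_le_iff₀ hε] at h2
  nlinarith [sq_nonneg (n : ℝ)]

end BinWord

/-! ### Walks in the Cayley digraph -/

namespace BinWord

lemma natCast_succ_zmod_two_mul_inj {n : ℕ} {a b : Fin n} :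
    (((a : ℕ) + 1 : ℕ) : ZMod (2 * n)) = (((b : ℕ) + 1 : ℕ) : ZMod (2 * n)) ↔ a = b := by
  have ha := a.2
  have hb := b.2
  rw [ZMod.natCast_eq_natCast_iff', Nat.mod_eq_of_lt (by omega), Nat.mod_eq_of_lt (by omega)]
  simp [Fin.ext_iff]

/-- The walk with starting vertex `p.1` and steps `p.2`. -/
def walkOfSteps {n ℓ : ℕ} (p : ZMod (2 * n) × (Fin ℓ → Fin n)) : Fin (ℓ + 1) → ZMod (2 * n) :=
  fun k => p.1 + Fin.partialSum (fun j => (((p.2 j : ℕ) + 1 : ℕ) : ZMod (2 * n))) k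

lemma walkOfSteps_succ {n ℓ : ℕ} (p : ZMod (2 * n) × (Fin ℓ → Fin n)) (k : Fin ℓ) :
    walkOfSteps p k.succ
      = walkOfSteps p k.castSucc + (((p.2 k : ℕ) + 1 : ℕ) : ZMod (2 * n)) := by
  rw [walkOfSteps, Fin.partialSum_succ, ← add_assoc]
  rfl

lemma walkOfSteps_injective {n ℓ : ℕ} :
    Function.Injective (walkOfSteps : ZMod (2 * n) × (Fin ℓ → Fin n) → _) := by
  intro p q h
  have h0 : p.1 = q.1 := by simpa [walkOfSteps] using congrFun h 0
  refine Prod.ext h0 (funext fun k => ?_)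
  have h1 := congrFun h k.succ
  rw [walkOfSteps_succ, walkOfSteps_succ, h, add_right_inj] at h1
  exact natCast_succ_zmod_two_mul_inj.1 h1

lemma adj_add_iff {n : ℕ} (w : BinWord n) (v : ZMod (2 * n)) (i : Fin n) :
    w.cayleyDigraph.Adj v (v + (((i : ℕ) + 1 : ℕ) : ZMod (2 * n))) ↔ w i = 1 := by
  simp only [cayleyDigraph, add_right_inj, natCast_succ_zmod_two_mul_inj]
  simp

/-- Steps lie in {1, …, n} and so are determined modulo 2n. A walk is thus the same as a starting
vertex with its steps, and the edge conditions read off the letters at those steps. -/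
lemma inducedWalkCount_eq {n ℓ : ℕ} (w : BinWord n) (u : BinWord ℓ) :
    w.inducedWalkCount u = 2 * n * w.subseqCount u := by
  have hset : {v : Fin (ℓ + 1) → ZMod (2 * n) | w.IsInducedWalk u v}
      = walkOfSteps '' (Set.univ ×ˢ {i : Fin ℓ → Fin n | StrictMono i ∧ ∀ k, w (i k) = u k}) := by
    have hiff : ∀ b c : Fin 2, (b = 1 ↔ c = 1) ↔ b = c := by decide
    ext v
    simp only [Set.mem_ofPred_eq, Set.mem_image, Set.mem_prod, Set.mem_univ, true_and, IsInducedWalk]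
    constructor
    · rintro ⟨⟨s, hs, hv⟩, hadj⟩
      refine ⟨(v 0, s), ⟨hs, fun k => ?_⟩, ?_⟩
      · have := hadj k
        rwa [hv, adj_add_iff, hiff] at this
      · ext k
        induction k using Fin.induction with
        | zero => simp [walkOfSteps]
        | succ k ih => rw [walkOfSteps_succ, ih, hv]
    · rintro ⟨p, ⟨hs, hu⟩, rfl⟩
      refine ⟨⟨p.2, hs, walkOfSteps_succ p⟩, fun k => ?_⟩
      rw [walkOfSteps_succ, adj_add_iff, hu]
  -- For n = 0 the vertex type is ℤ, whose `Nat.card` is 0 = 2 * 0, so no case split is needed.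
  rw [inducedWalkCount, hset, Set.ncard_image_of_injective _ walkOfSteps_injective, Set.ncard_prod,
    Set.ncard_univ, Nat.card_zmod, subseqCount]

lemma inducedWalkCount_isLittleO_iff (d : ℝ) (w : (n : ℕ) → BinWord n) (u : BinWord 3) :
    (fun n : ℕ => ((w n).inducedWalkCount u : ℝ) - u.prob d * (2 * (n : ℝ) * (n.choose 3 : ℝ)))
        =o[atTop] (fun n : ℕ => (n : ℝ) ^ 4) ↔
      (fun n : ℕ => ((w n).subseqCount u : ℝ) - u.prob d * (n.choose 3 : ℝ))
        =o[atTop] (fun n : ℕ => (n : ℝ) ^ 3) := by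
  have e1 : (fun n : ℕ => ((w n).inducedWalkCount u : ℝ)
      - u.prob d * (2 * (n : ℝ) * (n.choose 3 : ℝ)))
      = fun n : ℕ => 2 * ((n : ℝ) * (((w n).subseqCount u : ℝ) - u.prob d * (n.choose 3 : ℝ))) := by
    ext n
    rw [inducedWalkCount_eq]
    push_cast
    ring
  rw [e1, isLittleO_const_mul_left_iff two_ne_zero]
  constructor
  · intro h
    have := (isBigO_refl (fun n : ℕ => (n : ℝ)⁻¹) atTop).mul_isLittleO h
    refine this.congr' ?_ ?_ <;> filter_upwards [eventually_ne_atTop 0] with n hn <;> field_simp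
  · intro h
    refine ((isBigO_refl (fun n : ℕ => (n : ℝ)) atTop).mul_isLittleO h).congr_right fun n => ?_
    ring

end BinWord

/-! ### Small discrepancy implies equidistribution -/

lemma UnitAddCircle.norm_coe_le_abs (x : ℝ) : ‖(x : UnitAddCircle)‖ ≤ |x| := by
  simpa [UnitAddCircle.norm_eq] using round_le x 0

lemma LipschitzWith.norm_sub_coe_unitAddCircle_le {f : UnitAddCircle → ℂ} {K : NNReal}
    (hf : LipschitzWith K f) (x y : ℝ) :
    ‖f (x : UnitAddCircle) - f (y : UnitAddCircle)‖ ≤ K * |x - y| := by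
  refine (hf.norm_sub_le _ _).trans ?_
  rw [← AddCircle.coe_sub]
  gcongr
  exact UnitAddCircle.norm_coe_le_abs _

/-- On each interval [j/n, (j+1)/n] the function differs from its value at the right end by at most
K/n. -/
lemma LipschitzWith.norm_riemannSum_sub_integral_le {f : UnitAddCircle → ℂ} {K : NNReal}
    (hf : LipschitzWith K f) {n : ℕ} (hn : n ≠ 0) :
    ‖(1 / (n : ℂ)) * ∑ j ∈ Finset.range n, f ((((j : ℝ) + 1) / n : ℝ) : UnitAddCircle)
      - ∫ x : UnitAddCircle, f x‖ ≤ K / n := by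
  have hn0 : (0 : ℝ) < n := Nat.cast_pos.2 (Nat.pos_of_ne_zero hn)
  have hcont : Continuous fun x : ℝ => f (x : UnitAddCircle) :=
    hf.continuous.comp (AddCircle.continuous_mk' 1)
  have hI : ∫ x : UnitAddCircle, f x
      = ∑ j ∈ Finset.range n, ∫ x in ((j : ℕ) : ℝ) / n..((j + 1 : ℕ) : ℝ) / n, f (x : UnitAddCircle) := by
    rw [intervalIntegral.sum_integral_adjacent_intervals
      (a := fun j : ℕ => (j : ℝ) / n) fun j _ => hcont.intervalIntegrable _ _,
      ← UnitAddCircle.intervalIntegral_preimage 0]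
    simp [hn0.ne']
  have hterm : ∀ j ∈ Finset.range n,
      ‖(1 / (n : ℂ)) * f ((((j : ℝ) + 1) / n : ℝ) : UnitAddCircle)
        - ∫ x in ((j : ℕ) : ℝ) / n..((j + 1 : ℕ) : ℝ) / n, f (x : UnitAddCircle)‖
        ≤ K / n * (1 / n) := by
    intro j _
    have hlen : ((j + 1 : ℕ) : ℝ) / n - (j : ℝ) / n = 1 / n := by push_cast; ring
    have hle : (j : ℝ) / n ≤ ((j + 1 : ℕ) : ℝ) / n := by
      have : (0 : ℝ) < 1 / n := by positivity
      linarith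
    have hc : (1 / (n : ℂ)) * f ((((j : ℝ) + 1) / n : ℝ) : UnitAddCircle)
        = ∫ _x in ((j : ℕ) : ℝ) / n..((j + 1 : ℕ) : ℝ) / n,
            f ((((j : ℝ) + 1) / n : ℝ) : UnitAddCircle) := by
      rw [intervalIntegral.integral_const, hlen, Complex.real_smul]
      push_cast
      rfl
    rw [hc, ← intervalIntegral.integral_sub (by simp) (hcont.intervalIntegrable _ _)]
    refine (intervalIntegral.norm_integral_le_of_norm_le_const (C := K / n) fun x hx => ?_).trans ?_
    · rw [Set.uIoc_of_le hle] at hx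
      refine (hf.norm_sub_coe_unitAddCircle_le _ _).trans ?_
      rw [div_eq_mul_one_div (K : ℝ)]
      gcongr
      have h1 := hx.1
      have h2 := hx.2
      push_cast at h2 hlen
      rw [abs_of_nonneg (by linarith)]
      linarith
    · rw [hlen, abs_of_nonneg (by positivity)]
  rw [hI, Finset.mul_sum, ← Finset.sum_sub_distrib]
  refine (norm_sum_le _ _).trans ((Finset.sum_le_card_nsmul _ _ _ hterm).trans (le_of_eq ?_))
  rw [Finset.card_range, nsmul_eq_mul]
  field_simp

namespace BinWord

lemma norm_sum_letter_sub_smul_le {n : ℕ} {d δ : ℝ} (w : BinWord n)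
    (h : ∀ m ≤ n, |w.disc d m| ≤ δ) {f : UnitAddCircle → ℂ} {K : NNReal} (hf : LipschitzWith K f) :
    ‖∑ j ∈ Finset.range n, (w.letter j - d) • f ((((j : ℝ) + 1) / n : ℝ) : UnitAddCircle)‖
      ≤ δ * (‖f 0‖ + 2 * K) := by
  rcases Nat.eq_zero_or_pos n with rfl | hn
  · have := h 0 le_rfl
    simp only [disc_zero, abs_zero] at this
    simp only [Finset.range_zero, Finset.sum_empty, norm_zero]
    positivity
  have hn0 : (0 : ℝ) < n := Nat.cast_pos.2 hn
  have hδ : 0 ≤ δ := (abs_nonneg _).trans (h 0 (Nat.zero_le n))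
  refine (norm_sum_smul_le_of_abs_sum_le _
    (fun j : ℕ => f ((((j : ℝ) + 1) / n : ℝ) : UnitAddCircle)) n δ h).trans
    (mul_le_mul_of_nonneg_left ?_ hδ)
  have h1 : ‖f ((((n : ℝ) + 1) / n : ℝ) : UnitAddCircle)‖ ≤ ‖f 0‖ + K := by
    -- Abel summation leaves a boundary sample one place beyond the circle; periodicity brings it
    -- back to 1/n, near 0.
    have h2 : ((((n : ℝ) + 1) / n : ℝ) : UnitAddCircle) = ((1 / n : ℝ) : UnitAddCircle) := by
      rw [add_div, div_self hn0.ne', AddCircle.coe_add, AddCircle.coe_period, zero_add]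
    have h3 := hf.norm_sub_coe_unitAddCircle_le (1 / n) 0
    rw [h2]
    have h4 : |1 / (n : ℝ) - 0| ≤ 1 := by
      rw [sub_zero, abs_of_nonneg (by positivity), div_le_one hn0]
      exact_mod_cast hn
    have h5 := norm_le_norm_add_norm_sub' (f ((1 / n : ℝ) : UnitAddCircle)) (f ((0 : ℝ) : UnitAddCircle))
    have h6 : (K : ℝ) * |1 / (n : ℝ) - 0| ≤ K := mul_le_of_le_one_right K.2 h4
    rw [AddCircle.coe_zero] at h5 h3
    linarith
  have h2 : ∑ j ∈ Finset.range n, ‖f (((((j + 1 : ℕ) : ℝ) + 1) / n : ℝ) : UnitAddCircle)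
      - f ((((j : ℝ) + 1) / n : ℝ) : UnitAddCircle)‖ ≤ K := by
    refine (Finset.sum_le_card_nsmul _ _ ((K : ℝ) / n) fun j _ => ?_).trans (le_of_eq ?_)
    · refine (hf.norm_sub_coe_unitAddCircle_le _ _).trans (le_of_eq ?_)
      have : (((j + 1 : ℕ) : ℝ) + 1) / n - ((j : ℝ) + 1) / n = 1 / n := by push_cast; ring
      rw [this, abs_of_nonneg (by positivity)]
      ring
    · rw [Finset.card_range, nsmul_eq_mul]
      field_simp
  linarith

lemma SmallDisc.tendsto_equidistribution {d : ℝ} (hd0 : 0 ≤ d) (hd1 : d ≤ 1)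
    {w : (n : ℕ) → BinWord n} (h : SmallDisc d w) {f : UnitAddCircle → ℂ} {K : NNReal}
    (hf : LipschitzWith K f) :
    Tendsto (fun n : ℕ => (1 / (n : ℂ)) * ∑ j : Fin n, ((w n j : ℕ) : ℂ) *
        f (((((j : ℕ) : ℝ) + 1) / (n : ℝ) : ℝ) : UnitAddCircle))
      atTop (𝓝 ((d : ℂ) * ∫ x : UnitAddCircle, f x)) := by
  rw [Metric.tendsto_atTop']
  intro ε hε
  have hC : 0 < ‖f 0‖ + 2 * K + 1 := by positivity
  obtain ⟨N, hN⟩ := eventually_atTop.1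
    ((h (ε / 2 / (‖f 0‖ + 2 * K + 1)) (by positivity)).and
      (tendsto_natCast_atTop_atTop.eventually_gt_atTop (2 * K / ε)))
  refine ⟨N, fun n hn => ?_⟩
  obtain ⟨h1, h2⟩ := hN n hn.le
  have hn' : n ≠ 0 := by omega
  have hn0 : (0 : ℝ) < n := Nat.cast_pos.2 (by omega)
  -- Split w = (w - d) + d: the first part is a discrepancy sum, the second a Riemann sum.
  have hs : ∑ j : Fin n, ((w n j : ℕ) : ℂ) * f (((((j : ℕ) : ℝ) + 1) / (n : ℝ) : ℝ) : UnitAddCircle)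
      = ∑ j ∈ Finset.range n, ((w n).letter j - d) • f ((((j : ℝ) + 1) / n : ℝ) : UnitAddCircle)
        + d * ∑ j ∈ Finset.range n, f ((((j : ℝ) + 1) / n : ℝ) : UnitAddCircle) := by
    rw [Finset.mul_sum, ← Finset.sum_add_distrib, Finset.sum_range]
    refine Finset.sum_congr rfl fun j _ => ?_
    rw [letter_fin, Complex.real_smul]
    push_cast
    ring
  have e : (1 / (n : ℂ)) * ∑ j : Fin n, ((w n j : ℕ) : ℂ) *
        f (((((j : ℕ) : ℝ) + 1) / (n : ℝ) : ℝ) : UnitAddCircle) - d * ∫ x : UnitAddCircle, f x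
      = (1 / (n : ℂ)) * ∑ j ∈ Finset.range n,
          ((w n).letter j - d) • f ((((j : ℝ) + 1) / n : ℝ) : UnitAddCircle)
        + d * ((1 / (n : ℂ)) * ∑ j ∈ Finset.range n, f ((((j : ℝ) + 1) / n : ℝ) : UnitAddCircle)
          - ∫ x : UnitAddCircle, f x) := by
    rw [hs]
    ring
  have b1 : ‖(1 / (n : ℂ)) * ∑ j ∈ Finset.range n,
          ((w n).letter j - d) • f ((((j : ℝ) + 1) / n : ℝ) : UnitAddCircle)‖ ≤ ε / 2 := by
    have := norm_sum_letter_sub_smul_le (w n) h1 hf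
    rw [norm_mul, norm_div, norm_one, Complex.norm_natCast, one_div_mul_eq_div, div_le_iff₀ hn0]
    refine this.trans ?_
    have : ε / 2 / (‖f 0‖ + 2 * K + 1) * n * (‖f 0‖ + 2 * K)
        ≤ ε / 2 / (‖f 0‖ + 2 * K + 1) * n * (‖f 0‖ + 2 * K + 1) :=
      mul_le_mul_of_nonneg_left (by linarith) (by positivity)
    refine this.trans (le_of_eq ?_)
    field_simp
  have b2 : ‖(d : ℂ) * ((1 / (n : ℂ)) * ∑ j ∈ Finset.range n,
      f ((((j : ℝ) + 1) / n : ℝ) : UnitAddCircle) - ∫ x : UnitAddCircle, f x)‖ < ε / 2 := by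
    rw [norm_mul, Complex.norm_real, Real.norm_of_nonneg hd0]
    refine (mul_le_of_le_one_left (norm_nonneg _) hd1).trans_lt ?_
    refine (hf.norm_riemannSum_sub_integral_le hn').trans_lt ?_
    rw [div_lt_iff₀ hε] at h2
    rw [div_lt_iff₀ hn0]
    linarith
  rw [dist_eq_norm, e]
  exact (norm_add_le _ _).trans_lt (by linarith)

end BinWord

/-! ### Exponential sums and the variance of partial sums -/

lemma lipschitzWith_fourier_unitAddCircle (k : ℕ) :
    LipschitzWith (2 * Real.toNNReal Real.pi * k) (fun x : UnitAddCircle => fourier (k : ℤ) x) := by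
  refine LipschitzWith.of_dist_le_mul fun x y => ?_
  obtain ⟨t, ht⟩ : ∃ t : ℝ, (t : UnitAddCircle) = x - y := QuotientAddGroup.mk_surjective _
  -- The representative of x - y nearest to 0 has absolute value equal to the circle norm.
  set s : ℝ := t - round t with hs
  have hsx : (s : UnitAddCircle) = x - y := by
    rw [hs, AddCircle.coe_sub, ht, sub_eq_self]
    exact (AddCircle.coe_eq_zero_iff 1).2 ⟨round t, by simp⟩
  have hnorm : ‖x - y‖ = |s| := by rw [← ht, UnitAddCircle.norm_eq]
  have hx : x = y + s := by rw [hsx]; abel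
  rw [dist_eq_norm, dist_eq_norm, hnorm, hx]
  have e : fourier (k : ℤ) (y + (s : UnitAddCircle)) - fourier (k : ℤ) y
      = fourier (k : ℤ) y * (fourier (k : ℤ) (s : UnitAddCircle) - 1) := by
    rw [fourier_apply, zsmul_add, AddCircle.toCircle_add, Circle.coe_mul, fourier_apply, fourier_apply]
    ring
  have h1 : ‖fourier (k : ℤ) y‖ = 1 := by rw [fourier_apply]; exact Circle.norm_coe _
  rw [e, norm_mul, h1, one_mul, fourier_coe_apply]
  have e2 : 2 * (Real.pi : ℂ) * Complex.I * ((k : ℤ) : ℂ) * (s : ℂ) / ((1 : ℝ) : ℂ)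
      = Complex.I * ((2 * Real.pi * k * s : ℝ) : ℂ) := by
    push_cast
    ring
  rw [e2]
  refine Real.norm_exp_I_mul_ofReal_sub_one_le.trans (le_of_eq ?_)
  rw [Real.norm_eq_abs, abs_mul, abs_of_nonneg (by positivity)]
  simp [Real.pi_pos.le]

lemma integral_fourier_unitAddCircle {k : ℤ} (hk : k ≠ 0) :
    ∫ x : UnitAddCircle, fourier k x = 0 :=
  integral_eq_zero_of_add_right_eq_neg (fourier_add_half_inv_index hk one_pos)

lemma norm_sq_sum_mul_exp (n : ℕ) (g θ : ℕ → ℝ) :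
    ‖∑ j ∈ Finset.range n, (g j : ℂ) * Complex.exp (θ j * Complex.I)‖ ^ 2
      = ∑ i ∈ Finset.range n, ∑ j ∈ Finset.range n, g i * g j * Real.cos (θ i - θ j) := by
  have hre : (∑ j ∈ Finset.range n, (g j : ℂ) * Complex.exp (θ j * Complex.I)).re
      = ∑ j ∈ Finset.range n, g j * Real.cos (θ j) := by
    rw [Complex.re_sum]
    exact Finset.sum_congr rfl fun j _ => by
      rw [Complex.re_ofReal_mul, Complex.exp_ofReal_mul_I_re]
  have him : (∑ j ∈ Finset.range n, (g j : ℂ) * Complex.exp (θ j * Complex.I)).im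
      = ∑ j ∈ Finset.range n, g j * Real.sin (θ j) := by
    rw [Complex.im_sum]
    exact Finset.sum_congr rfl fun j _ => by
      rw [Complex.im_ofReal_mul, Complex.exp_ofReal_mul_I_im]
  rw [← Complex.normSq_eq_norm_sq, Complex.normSq_apply, hre, him, Finset.sum_mul_sum,
    Finset.sum_mul_sum, ← Finset.sum_add_distrib]
  refine Finset.sum_congr rfl fun i _ => ?_
  rw [← Finset.sum_add_distrib]
  refine Finset.sum_congr rfl fun j _ => ?_
  rw [Real.cos_sub]
  ring

/-- The Fourier series of the Bernoulli polynomial B₂. The term k = 0 vanishes because 1 / 0 = 0. -/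
lemma hasSum_one_div_sq_mul_cos {x : ℝ} (hx : x ∈ Set.Icc (0 : ℝ) 1) :
    HasSum (fun k : ℕ => 1 / (k : ℝ) ^ 2 * Real.cos (2 * Real.pi * k * x))
      (Real.pi ^ 2 * (x ^ 2 - x + 1 / 6)) := by
  have h := hasSum_one_div_nat_pow_mul_cos one_ne_zero hx
  have hb : (Polynomial.map (algebraMap ℚ ℝ) (Polynomial.bernoulli (2 * 1))).eval x
      = x ^ 2 - x + 1 / 6 := by
    rw [Polynomial.bernoulli_def]
    simp [Finset.sum_range_succ, bernoulli_eq_bernoulli'_of_ne_one]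
    ring
  rw [hb] at h
  convert h using 1
  norm_num
  ring

/-- The squared modulus of the exponential sum of frequency `k / n` of the centred letters. -/
noncomputable def fourierSq (n : ℕ) (g : ℕ → ℝ) (k : ℕ) : ℝ :=
  ‖∑ j ∈ Finset.range n,
    (g j : ℂ) * Complex.exp (((2 * Real.pi / n * k * (j + 1) : ℝ) : ℂ) * Complex.I)‖ ^ 2

lemma fourierSq_le {n : ℕ} {g : ℕ → ℝ} (hg : ∀ j, |g j| ≤ 1) (k : ℕ) :
    fourierSq n g k ≤ (n : ℝ) ^ 2 := by
  refine pow_le_pow_left₀ (norm_nonneg _) ((norm_sum_le _ _).trans ?_) 2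
  refine (Finset.sum_le_card_nsmul _ _ 1 fun j _ => ?_).trans (by simp)
  rw [norm_mul, Complex.norm_exp_ofReal_mul_I, mul_one, Complex.norm_real]
  exact hg j

/-- Expanding the squared modulus gives cosines of 2πk(i - j)/n; summing over k with weights 1/k²
turns each into B₂ at |i - j|/n, which lies in [0, 1]. -/
lemma hasSum_fourierSq (n : ℕ) (g : ℕ → ℝ) :
    HasSum (fun k : ℕ => 1 / (k : ℝ) ^ 2 * fourierSq n g k)
      (Real.pi ^ 2 * ∑ i ∈ Finset.range n, ∑ j ∈ Finset.range n, g i * g j *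
        ((|(i : ℝ) - j| / n) ^ 2 - |(i : ℝ) - j| / n + 1 / 6)) := by
  have h : ∀ i ∈ Finset.range n, ∀ j ∈ Finset.range n,
      HasSum (fun k : ℕ => g i * g j * (1 / (k : ℝ) ^ 2 * Real.cos (2 * Real.pi * k * (|(i : ℝ) - j| / n))))
        (g i * g j * (Real.pi ^ 2 * ((|(i : ℝ) - j| / n) ^ 2 - |(i : ℝ) - j| / n + 1 / 6))) := by
    intro i hi j hj
    refine (hasSum_one_div_sq_mul_cos ⟨by positivity, ?_⟩).mul_left _
    have hi' : (i : ℝ) < n := Nat.cast_lt.2 (Finset.mem_range.1 hi)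
    have hj' : (j : ℝ) < n := Nat.cast_lt.2 (Finset.mem_range.1 hj)
    have hi0 : (0 : ℝ) ≤ i := Nat.cast_nonneg i
    have hj0 : (0 : ℝ) ≤ j := Nat.cast_nonneg j
    rw [div_le_one (by linarith)]
    exact abs_le.2 ⟨by linarith, by linarith⟩
  convert hasSum_sum fun i hi => hasSum_sum fun j hj => h i hi j hj using 1
  · ext k
    rw [fourierSq, norm_sq_sum_mul_exp, Finset.mul_sum]
    refine Finset.sum_congr rfl fun i _ => ?_
    rw [Finset.mul_sum]
    refine Finset.sum_congr rfl fun j _ => ?_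
    have : Real.cos (2 * Real.pi / n * k * (i + 1) - 2 * Real.pi / n * k * (j + 1))
        = Real.cos (2 * Real.pi * k * (|(i : ℝ) - j| / n)) := by
      have e : 2 * Real.pi * k * (|(i : ℝ) - j| / n) = |2 * Real.pi * k / n * (i - j)| := by
        rw [abs_mul, abs_of_nonneg (show 0 ≤ 2 * Real.pi * k / n by positivity)]
        ring
      rw [e, Real.cos_abs]
      congr 1
      ring
    rw [this]
    ring
  · rw [Finset.mul_sum]
    refine Finset.sum_congr rfl fun i _ => ?_
    rw [Finset.mul_sum]
    exact Finset.sum_congr rfl fun j _ => by ring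

lemma sum_indicator_le_mul_indicator_le {n i j : ℕ} (hi : i < n) (hj : j < n) :
    ∑ m ∈ Finset.range n, (if i ≤ m then (1 : ℝ) else 0) * (if j ≤ m then 1 else 0)
      = n - max (i : ℝ) j := by
  have h : ∀ m, (if i ≤ m then (1 : ℝ) else 0) * (if j ≤ m then 1 else 0)
      = if max i j ≤ m then 1 else 0 := by
    intro m
    by_cases h1 : i ≤ m <;> by_cases h2 : j ≤ m <;> simp [h1, h2]
  have h' : (Finset.range n).filter (fun m => max i j ≤ m) = Finset.Ico (max i j) n := by
    ext m
    simp only [Finset.mem_filter, Finset.mem_range, Finset.mem_Ico]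
    exact and_comm
  rw [Finset.sum_congr rfl fun m _ => h m, ← Finset.natCast_card_filter, h', Nat.card_Ico,
    Nat.cast_sub (max_le hi.le hj.le), Nat.cast_max]

/-- The variance of the partial sums of `g` as a quadratic form: up to terms with a factor
`∑ i, g i`, its kernel is the second periodic Bernoulli function. -/
lemma variance_partialSum (n : ℕ) (g : ℕ → ℝ) :
    n * ∑ m ∈ Finset.range n, (∑ i ∈ Finset.range (m + 1), g i) ^ 2
        - (∑ m ∈ Finset.range n, ∑ i ∈ Finset.range (m + 1), g i) ^ 2
      = (n : ℝ) ^ 2 / 2 * ∑ i ∈ Finset.range n, ∑ j ∈ Finset.range n, g i * g j *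
          ((|(i : ℝ) - j| / n) ^ 2 - |(i : ℝ) - j| / n + 1 / 6)
        + (∑ i ∈ Finset.range n, g i) * ∑ i ∈ Finset.range n, g i * (n * i - i ^ 2)
        - (n : ℝ) ^ 2 / 12 * (∑ i ∈ Finset.range n, g i) ^ 2 := by
  have hG : ∀ m ∈ Finset.range n, ∑ i ∈ Finset.range (m + 1), g i
      = ∑ i ∈ Finset.range n, g i * if i ≤ m then 1 else 0 := by
    intro m hm
    simp only [mul_ite, mul_one, mul_zero]
    rw [← Finset.sum_filter]
    congr 1
    ext i
    simp only [Finset.mem_filter, Finset.mem_range] at hm ⊢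
    omega
  have hsq : ∑ m ∈ Finset.range n, (∑ i ∈ Finset.range (m + 1), g i) ^ 2
      = ∑ i ∈ Finset.range n, ∑ j ∈ Finset.range n, g i * g j * (n - max (i : ℝ) j) := by
    have : ∀ m ∈ Finset.range n, (∑ i ∈ Finset.range (m + 1), g i) ^ 2
        = ∑ i ∈ Finset.range n, ∑ j ∈ Finset.range n,
          g i * g j * ((if i ≤ m then 1 else 0) * (if j ≤ m then 1 else 0)) := by
      intro m hm
      rw [hG m hm, sq, Finset.sum_mul_sum]
      exact Finset.sum_congr rfl fun i _ => Finset.sum_congr rfl fun j _ => by ring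
    rw [Finset.sum_congr rfl this, Finset.sum_comm]
    refine Finset.sum_congr rfl fun i hi => ?_
    rw [Finset.sum_comm]
    refine Finset.sum_congr rfl fun j hj => ?_
    rw [← Finset.mul_sum, sum_indicator_le_mul_indicator_le (Finset.mem_range.1 hi) (Finset.mem_range.1 hj)]
  have hlin : ∑ m ∈ Finset.range n, ∑ i ∈ Finset.range (m + 1), g i
      = ∑ i ∈ Finset.range n, g i * (n - i) := by
    rw [Finset.sum_congr rfl hG, Finset.sum_comm]
    refine Finset.sum_congr rfl fun i hi => ?_
    rw [← Finset.mul_sum]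
    congr 1
    have := sum_indicator_le_mul_indicator_le (Finset.mem_range.1 hi) (Finset.mem_range.1 hi)
    simpa only [max_self, ite_mul_ite, mul_one, mul_zero, and_self] using this
  -- Symmetrised in i and j, so that the identity can be checked on each coefficient of g i * g j.
  have hE : (∑ i ∈ Finset.range n, g i) * ∑ i ∈ Finset.range n, g i * (n * i - i ^ 2)
      = ∑ i ∈ Finset.range n, ∑ j ∈ Finset.range n,
          g i * g j * (((n * i - i ^ 2 : ℝ) + (n * j - j ^ 2)) / 2) := by
    have h1 := Finset.sum_mul_sum (Finset.range n) (Finset.range n) g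
      (fun i => g i * (n * i - i ^ 2 : ℝ))
    have h2 := Finset.sum_mul_sum (Finset.range n) (Finset.range n)
      (fun i => g i * (n * i - i ^ 2 : ℝ)) g
    have h3 : (∑ i ∈ Finset.range n, g i) * ∑ i ∈ Finset.range n, g i * (n * i - i ^ 2 : ℝ)
        = ((∑ i ∈ Finset.range n, g i) * (∑ i ∈ Finset.range n, g i * (n * i - i ^ 2 : ℝ))
          + (∑ i ∈ Finset.range n, g i * (n * i - i ^ 2 : ℝ)) * ∑ i ∈ Finset.range n, g i) / 2 := by
      ring
    rw [h3, h1, h2, ← Finset.sum_add_distrib, Finset.sum_div]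
    refine Finset.sum_congr rfl fun i _ => ?_
    rw [← Finset.sum_add_distrib, Finset.sum_div]
    exact Finset.sum_congr rfl fun j _ => by ring
  rw [hsq, hlin, hE, sq (∑ i ∈ Finset.range n, g i), sq (∑ i ∈ Finset.range n, g i * _),
    Finset.sum_mul_sum, Finset.sum_mul_sum]
  simp only [Finset.mul_sum, ← Finset.sum_add_distrib, ← Finset.sum_sub_distrib]
  refine Finset.sum_congr rfl fun i hi => Finset.sum_congr rfl fun j _ => ?_
  have hn : (n : ℝ) ≠ 0 := Nat.cast_ne_zero.2 (by have := Finset.mem_range.1 hi; omega)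
  have hk : (n : ℝ) ^ 2 * ((|(i : ℝ) - j| / n) ^ 2 - |(i : ℝ) - j| / n + 1 / 6)
      = ((i : ℝ) - j) ^ 2 - n * |(i : ℝ) - j| + n ^ 2 / 6 := by
    rw [← sq_abs ((i : ℝ) - j)]
    field_simp
  have hmax : max (i : ℝ) j = (i + j + |(i : ℝ) - j|) / 2 := by
    rcases le_total (i : ℝ) j with h | h
    · rw [max_eq_right h, abs_of_nonpos (by linarith)]; ring
    · rw [max_eq_left h, abs_of_nonneg (by linarith)]; ring
  rw [hmax]
  linear_combination (-(g i * g j) / 2) * hk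

lemma sum_sq_sub_mean_le {n : ℕ} (hn : n ≠ 0) {g : ℕ → ℝ} (hg : ∀ j, |g j| ≤ 1) :
    ∃ μ : ℝ, ∑ m ∈ Finset.range n, (∑ i ∈ Finset.range m, g i - μ) ^ 2
      ≤ (n : ℝ) * (∑' k : ℕ, 1 / (k : ℝ) ^ 2 * fourierSq n g k)
        + |∑ i ∈ Finset.range n, g i| * n ^ 2 + n ^ 2 := by
  have hn0 : (0 : ℝ) < n := Nat.cast_pos.2 (Nat.pos_of_ne_zero hn)
  set S := ∑' k : ℕ, 1 / (k : ℝ) ^ 2 * fourierSq n g k with hS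
  set E := ∑ i ∈ Finset.range n, g i with hE
  set G : ℕ → ℝ := fun m => ∑ i ∈ Finset.range m, g i with hG
  -- μ is the mean of the partial sums of lengths 1, …, n. Passing to lengths 0, …, n - 1 costs at
  -- most μ² ≤ n², the last summand of the bound.
  set μ : ℝ := (∑ m ∈ Finset.range n, G (m + 1)) / n with hμ
  have hS0 : 0 ≤ S := tsum_nonneg fun k => mul_nonneg (by positivity) (sq_nonneg _)
  have hvar := variance_partialSum n g
  have hker := (hasSum_fourierSq n g).tsum_eq
  rw [← hS] at hker
  set B := ∑ i ∈ Finset.range n, ∑ j ∈ Finset.range n, g i * g j *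
          ((|(i : ℝ) - j| / n) ^ 2 - |(i : ℝ) - j| / n + 1 / 6) with hB
  have hBS : B ≤ S := by
    have hπ : 1 ≤ Real.pi ^ 2 := by nlinarith [Real.pi_gt_three]
    have hB0 : 0 ≤ B := by
      by_contra hneg
      nlinarith
    nlinarith
  have hcross : E * ∑ i ∈ Finset.range n, g i * (n * i - i ^ 2 : ℝ) ≤ |E| * n ^ 3 := by
    refine (le_abs_self _).trans ?_
    rw [abs_mul]
    refine mul_le_mul_of_nonneg_left ?_ (abs_nonneg _)
    refine (Finset.abs_sum_le_sum_abs _ _).trans ?_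
    refine (Finset.sum_le_card_nsmul _ _ ((n : ℝ) ^ 2) fun i hi => ?_).trans (le_of_eq ?_)
    · have hi' : (i : ℝ) < n := Nat.cast_lt.2 (Finset.mem_range.1 hi)
      have hi0 : (0 : ℝ) ≤ i := Nat.cast_nonneg i
      rw [abs_mul]
      refine (mul_le_of_le_one_left (abs_nonneg _) (hg i)).trans (abs_le.2 ⟨?_, ?_⟩) <;> nlinarith
    · rw [Finset.card_range, nsmul_eq_mul]
      ring
  have hshift : ∑ m ∈ Finset.range n, (G (m + 1) - μ) ^ 2 ≤ n * S + |E| * n ^ 2 := by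
    have e : n * ∑ m ∈ Finset.range n, (G (m + 1) - μ) ^ 2
        = n * ∑ m ∈ Finset.range n, G (m + 1) ^ 2 - (∑ m ∈ Finset.range n, G (m + 1)) ^ 2 := by
      have h1 : ∑ m ∈ Finset.range n, G (m + 1) = n * μ := by rw [hμ]; field_simp
      have h2 : ∀ m, (G (m + 1) - μ) ^ 2 = G (m + 1) ^ 2 - 2 * μ * G (m + 1) + μ ^ 2 := fun m => by ring
      simp only [h2]
      rw [Finset.sum_add_distrib, Finset.sum_sub_distrib, ← Finset.mul_sum, h1, Finset.sum_const,
        Finset.card_range, nsmul_eq_mul]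
      ring
    have h3 : (n : ℝ) * ∑ m ∈ Finset.range n, (G (m + 1) - μ) ^ 2
        ≤ n * (n * S + |E| * n ^ 2) := by
      rw [e, hvar]
      have h4 : (n : ℝ) ^ 2 / 2 * B ≤ n ^ 2 * S := by nlinarith [sq_nonneg (n : ℝ)]
      have h5 : 0 ≤ (n : ℝ) ^ 2 / 12 * E ^ 2 := by positivity
      nlinarith
    exact le_of_mul_le_mul_left h3 hn0
  have hμn : μ ^ 2 ≤ (n : ℝ) ^ 2 := by
    have h1 : |∑ m ∈ Finset.range n, G (m + 1)| ≤ n * n := by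
      refine (Finset.abs_sum_le_sum_abs _ _).trans ?_
      refine (Finset.sum_le_card_nsmul _ _ (n : ℝ) fun m hm => ?_).trans (by simp)
      refine (Finset.abs_sum_le_sum_abs _ _).trans ?_
      refine (Finset.sum_le_card_nsmul _ _ 1 fun i _ => hg i).trans ?_
      rw [Finset.card_range, nsmul_eq_mul, mul_one]
      exact Nat.cast_le.2 (Finset.mem_range.1 hm)
    rw [sq_le_sq, hμ, abs_div, abs_of_pos hn0, div_le_iff₀ hn0]
    exact h1
  refine ⟨μ, ?_⟩
  have h6 : ∑ m ∈ Finset.range n, (G m - μ) ^ 2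
      ≤ ∑ m ∈ Finset.range n, (G (m + 1) - μ) ^ 2 + (G 0 - μ) ^ 2 := by
    rw [← Finset.sum_range_succ' (fun m => (G m - μ) ^ 2), Finset.sum_range_succ]
    exact le_add_of_nonneg_right (sq_nonneg _)
  have h7 : (G 0 - μ) ^ 2 = μ ^ 2 := by simp [hG]
  linarith

/-- A geometric sum over an n-th root of unity other than 1. It makes the exponential sums
insensitive to subtracting d from the letters. -/
lemma sum_exp_eq_zero {n k : ℕ} (hk : k ≠ 0) (hkn : k < n) :
    ∑ j ∈ Finset.range n,
      Complex.exp (((2 * Real.pi / n * k * (j + 1) : ℝ) : ℂ) * Complex.I) = 0 := by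
  have hn : (n : ℂ) ≠ 0 := Nat.cast_ne_zero.2 (by omega)
  set z := Complex.exp (2 * Real.pi * Complex.I * (k / n)) with hz
  have hterm : ∀ j : ℕ, Complex.exp (((2 * Real.pi / n * k * (j + 1) : ℝ) : ℂ) * Complex.I)
      = z * z ^ j := by
    intro j
    rw [← pow_succ', hz, ← Complex.exp_nat_mul]
    congr 1
    push_cast
    ring
  have hzn : z ^ n = 1 := by
    rw [hz, ← Complex.exp_nat_mul, Complex.exp_eq_one_iff]
    exact ⟨k, by push_cast; field_simp⟩
  have hz1 : z ≠ 1 := by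
    rw [hz, Ne, Complex.exp_eq_one_iff]
    rintro ⟨m, hm⟩
    rw [mul_comm (m : ℂ)] at hm
    have h1 := mul_left_cancel₀ Complex.two_pi_I_ne_zero hm
    rw [div_eq_iff hn] at h1
    have h2 : (k : ℤ) = m * n := by exact_mod_cast h1
    have h3 : n ∣ k := Int.natCast_dvd_natCast.1 ⟨m, by rw [h2, mul_comm]⟩
    exact absurd (Nat.le_of_dvd (Nat.pos_of_ne_zero hk) h3) (not_le.2 hkn)
  simp only [hterm]
  rw [← Finset.mul_sum, geom_sum_eq hz1, hzn]
  simp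

namespace BinWord

lemma tendsto_fourierSq {d : ℝ} {w : (n : ℕ) → BinWord n} {k : ℕ} (hk : k ≠ 0)
    (h : Tendsto (fun n : ℕ => (1 / (n : ℂ)) * ∑ j : Fin n, ((w n j : ℕ) : ℂ) *
        Complex.exp (2 * (Real.pi : ℂ) * Complex.I / (n : ℂ) * (k : ℂ) * (((j : ℕ) : ℂ) + 1)))
      atTop (𝓝 0)) :
    Tendsto (fun n : ℕ => fourierSq n (fun j => (w n).letter j - d) k / (n : ℝ) ^ 2) atTop (𝓝 0) := by
  have h2 := (h.norm.pow 2)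
  rw [norm_zero, zero_pow two_ne_zero] at h2
  refine h2.congr' ?_
  filter_upwards [eventually_gt_atTop k] with n hn
  rw [fourierSq, norm_mul, norm_div, norm_one, Complex.norm_natCast, mul_pow, one_div, inv_pow,
    inv_mul_eq_div]
  congr 3
  simp only [Complex.ofReal_sub, sub_mul]
  rw [Finset.sum_sub_distrib, ← Finset.mul_sum, sum_exp_eq_zero hk hn, mul_zero, sub_zero,
    Finset.sum_range]
  refine Finset.sum_congr rfl fun j _ => ?_
  rw [letter_fin]
  push_cast
  congr 2
  ring

lemma smallDisc_of_exponentialSums {d : ℝ} (hd0 : 0 ≤ d) (hd1 : d ≤ 1) {w : (n : ℕ) → BinWord n}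
    (hw : (fun n : ℕ => ((w n).norm1 : ℝ) - d * (n : ℝ)) =o[atTop] (fun n : ℕ => (n : ℝ)))
    (h : ∀ k : ℕ, k ≠ 0 →
      Tendsto (fun n : ℕ => (1 / (n : ℂ)) * ∑ j : Fin n, ((w n j : ℕ) : ℂ) *
        Complex.exp (2 * (Real.pi : ℂ) * Complex.I / (n : ℂ) * (k : ℂ) * (((j : ℕ) : ℂ) + 1)))
      atTop (𝓝 0)) :
    SmallDisc d w := by
  have htsum : Tendsto (fun n : ℕ => ∑' k : ℕ, 1 / (k : ℝ) ^ 2 *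
      (fourierSq n (fun j => (w n).letter j - d) k / (n : ℝ) ^ 2)) atTop (𝓝 0) := by
    -- Dominated convergence with majorant 1/k²: no uniformity in the frequency is required.
    rw [← tsum_zero (α := ℝ) (β := ℕ)]
    refine tendsto_tsum_of_dominated_convergence
      (Real.summable_one_div_nat_pow.2 one_lt_two) (fun k => ?_) (Eventually.of_forall fun n k => ?_)
    · rcases eq_or_ne k 0 with rfl | hk
      · simp
      · rw [← mul_zero (1 / (k : ℝ) ^ 2)]
        exact (tendsto_fourierSq hk (h k hk)).const_mul _
    · have h0 : 0 ≤ fourierSq n (fun j => (w n).letter j - d) k := sq_nonneg _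
      rw [Real.norm_of_nonneg (by positivity)]
      refine mul_le_of_le_one_right (by positivity) (div_le_one_of_le₀ ?_ (by positivity))
      exact fourierSq_le (fun j => abs_letter_sub_le_one hd0 hd1 (w n) j) k
  refine smallDisc_of_sum_sq hd0 hd1 fun ε hε => ?_
  -- One third each for the nonzero frequencies, the total discrepancy and the n² error.
  have hε3 : 0 < ε / 3 := by positivity
  filter_upwards [htsum.eventually_lt_const hε3, hw.def hε3, eventually_ne_atTop 0,
    tendsto_natCast_atTop_atTop.eventually_ge_atTop (3 / ε)] with n h1 h2 hn h3
  have hn0 : (0 : ℝ) < n := Nat.cast_pos.2 (Nat.pos_of_ne_zero hn)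
  obtain ⟨μ, hμ⟩ := sum_sq_sub_mean_le hn fun j => abs_letter_sub_le_one hd0 hd1 (w n) j
  refine ⟨μ, hμ.trans ?_⟩
  set S := ∑' k : ℕ, 1 / (k : ℝ) ^ 2 * fourierSq n (fun j => (w n).letter j - d) k with hS
  have hS1 : S ≤ ε / 3 * n ^ 2 := by
    simp only [mul_div_assoc'] at h1
    rw [tsum_div_const, ← hS, div_lt_iff₀ (by positivity)] at h1
    exact h1.le
  have hE : |∑ i ∈ Finset.range n, ((w n).letter i - d)| ≤ ε / 3 * n := by
    have := disc_self d (w n)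
    rw [disc] at this
    rw [this]
    simpa using h2
  rw [div_le_iff₀ hε] at h3
  have hS2 : n * S ≤ n * (ε / 3 * n ^ 2) := mul_le_mul_of_nonneg_left hS1 hn0.le
  have hE2 := mul_le_mul_of_nonneg_right hE (sq_nonneg (n : ℝ))
  nlinarith [sq_nonneg (n : ℝ)]

lemma tendsto_exponentialSum_of_equidistribution {d : ℝ} {w : (n : ℕ) → BinWord n}
    (h : ∀ f : UnitAddCircle → ℂ, (∃ K : NNReal, LipschitzWith K f) →
        Tendsto (fun n : ℕ => (1 / (n : ℂ)) * ∑ j : Fin n, ((w n j : ℕ) : ℂ) *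
            f (((((j : ℕ) : ℝ) + 1) / (n : ℝ) : ℝ) : UnitAddCircle))
          atTop (𝓝 ((d : ℂ) * ∫ x : UnitAddCircle, f x))) {k : ℕ} (hk : k ≠ 0) :
    Tendsto (fun n : ℕ => (1 / (n : ℂ)) * ∑ j : Fin n, ((w n j : ℕ) : ℂ) *
        Complex.exp (2 * (Real.pi : ℂ) * Complex.I / (n : ℂ) * (k : ℂ) * (((j : ℕ) : ℂ) + 1)))
      atTop (𝓝 0) := by
  have h1 := h (fun x => fourier (k : ℤ) x) ⟨_, lipschitzWith_fourier_unitAddCircle k⟩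
  rw [integral_fourier_unitAddCircle (Int.natCast_ne_zero.2 hk), mul_zero] at h1
  refine h1.congr fun n => ?_
  congr 1
  refine Finset.sum_congr rfl fun j _ => ?_
  rw [fourier_coe_apply]
  congr 2
  push_cast
  ring

end BinWord

theorem theorem2 (d : ℝ) (hd0 : 0 ≤ d) (hd1 : d ≤ 1) (w : (n : ℕ) → BinWord n)
    (hw : (fun n : ℕ => ((w n).norm1 : ℝ) - d * (n : ℝ)) =o[atTop] (fun n : ℕ => (n : ℝ))) :
    List.TFAE [
      -- Uniformity
      ∃ ε : ℕ → ℝ, Tendsto ε atTop (𝓝 0) ∧ ∀ n, (w n).IsUniform d (ε n),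
      -- Counting
      ∀ (ℓ : ℕ) (u : BinWord ℓ),
        (fun n : ℕ => ((w n).subseqCount u : ℝ) - u.prob d * (n.choose ℓ : ℝ))
          =o[atTop] (fun n : ℕ => (n : ℝ) ^ ℓ),
      -- Minimizer
      ∀ u : BinWord 3,
        (fun n : ℕ => ((w n).subseqCount u : ℝ) - u.prob d * (n.choose 3 : ℝ))
          =o[atTop] (fun n : ℕ => (n : ℝ) ^ 3),
      -- Exponential sums
      ∀ k : ℕ, k ≠ 0 →
        Tendsto (fun n : ℕ => (1 / (n : ℂ)) * ∑ j : Fin n, ((w n j : ℕ) : ℂ) *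
            Complex.exp (2 * (Real.pi : ℂ) * Complex.I / (n : ℂ) * (k : ℂ) * (((j : ℕ) : ℂ) + 1)))
          atTop (𝓝 0),
      -- Equidistribution
      ∀ f : UnitAddCircle → ℂ, (∃ K : NNReal, LipschitzWith K f) →
        Tendsto (fun n : ℕ => (1 / (n : ℂ)) * ∑ j : Fin n, ((w n j : ℕ) : ℂ) *
            f (((((j : ℕ) : ℝ) + 1) / (n : ℝ) : ℝ) : UnitAddCircle))
          atTop (𝓝 ((d : ℂ) * ∫ x : UnitAddCircle, f x)),
      -- Cayley graph
      ∀ u : BinWord 3,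
        (fun n : ℕ => ((w n).inducedWalkCount u : ℝ) - u.prob d * (2 * (n : ℝ) * (n.choose 3 : ℝ)))
          =o[atTop] (fun n : ℕ => (n : ℝ) ^ 4)] := by
  tfae_have 1 → 2 := fun h ℓ u =>
    (BinWord.exists_isUniform_iff_smallDisc.1 h).subseqCount_isLittleO hd0 hd1 ℓ u
  tfae_have 2 → 3 := fun h => h 3
  tfae_have 3 → 1 := fun h => BinWord.exists_isUniform_iff_smallDisc.2
    (BinWord.smallDisc_of_subseqCount_three hd0 hd1 h)
  tfae_have 1 → 5 := fun h f ⟨_, hf⟩ =>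
    (BinWord.exists_isUniform_iff_smallDisc.1 h).tendsto_equidistribution hd0 hd1 hf
  tfae_have 5 → 4 := fun h _ hk => BinWord.tendsto_exponentialSum_of_equidistribution h hk
  tfae_have 4 → 1 := fun h => BinWord.exists_isUniform_iff_smallDisc.2
    (BinWord.smallDisc_of_exponentialSums hd0 hd1 hw h)
  tfae_have 6 ↔ 3 := forall_congr' fun u => BinWord.inducedWalkCount_isLittleO_iff d w u
  tfae_finish
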